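/- All multigraphs are finite, undirected and loopless, and may have multiple edges; the multigraph without vertices is allowed. For $k\ge 0$, a $k$-labeled multigraph is a multigraph in which $k$ distinct vertices carry the labels $1,\dots,k$. Let $\mathcal G_k$ be the commutative monoid of isomorphism classes of $k$-labeled multigraphs (isomorphisms respect the labels), where the product of $F$ and $G$ is obtained from the disjoint union of $F$ and $G$ by identifying vertices with the same label and keeping all edges with their multiplicities. Let $\mathcal A_k=\mathbb R[\mathcal G_k]$ be its monoid algebra, and let $\mathcal A_k^0\subseteq\mathcal A_k$ be the subalgebra spanned by the multigraphs all of whose vertices are labeled. For $1\le i<j\le k$ let $z_{ij}\in\mathcal A_k^0$ be the multigraph with vertices $1,\dots,k$ and a single edge $ij$. Elements of $\mathcal A_0$ are called quantum multigraphs; a real number $\epsilon$ is identified with $\epsilon$ times the identity (the multigraph without vertices). A graph parameter is a map $t:\mathcal G_0\to\mathbb R$; it is extended linearly to $\mathcal A_0$, and to each $\mathcal A_k$ by ignoring labels. It is isolate indifferent if its value does not change when an isolated vertex is added; flatly reflection positive if $t(b^2)\ge 0$ for all $k$ and all $b\in\mathcal A_k^0$; and, for $d\in\mathbb R$, $d$-bounded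 if $|t(K_2^m)|\le d^m$ for all integers $m\ge 0$, where $K_2^m$ is the multigraph with two vertices and $m$ edges between them. For elements $r_1,\dots,r_m$ of a commutative ring $R$, let $\mathrm{PO}(r_1,\dots,r_m)=\{\sum_{e\in\{0,1\}^m}\sigma_e r_1^{e_1}\cdots r_m^{e_m}\mid \sigma_e \text{ a sum of squares in } R\}$ be the preorder they generate, and let $\mathcal P_k(d)=\mathrm{PO}(d+z_{ij},\,d-z_{ij}\mid 1\le i<j\le k)\subseteq\mathcal A_k^0$. A quantum multigraph $a$ and an element $\sigma\in\mathcal A_k$ coincide up to labels and isolated vertices if $a$ and the quantum multigraph obtained from $\sigma$ by removing all labels differ by an element of the linear span of all $G'-G$, where $G\in\mathcal G_0$ and $G'$ is $G$ with one isolated vertex added. **Theorem.** Let $d\in\mathbb R$ and let $a$ be a quantum multigraph. Then $t(a)\ge 0$ for every isolate indifferent, flatly reflection positive and $d$-bounded graph parameter $t$ if and only if for each $\epsilon>0$ there are some $k\ge 0$ and some $\sigma\in\mathcal P_k(d)$ such that $a+\epsilon$ and $\sigma$ coincide up to labels and isolated vertices. -/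

import Mathlib

/-- A `k`-labeled multigraph: finite, undirected, loopless, with multiple edges allowed.
The labeled vertices are `Sum.inl i` for `i : Fin k`; the unlabeled ones are `Sum.inr j` for
`j : Fin n`. The edges form a multiset of unordered pairs of distinct vertices. -/
structure LabeledMultigraph (k : ℕ) where
  n : ℕ
  edges : Multiset (Sym2 (Fin k ⊕ Fin n))
  loopless : ∀ e ∈ edges, ¬ e.IsDiag

namespace LabeledMultigraph

variable {k : ℕ}

/-- Isomorphism of `k`-labeled multigraphs: a bijection of the vertices that respects the labels
and carries the edges, with their multiplicities, to the edges. -/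
def Iso (G H : LabeledMultigraph k) : Prop :=
  ∃ s : Fin G.n ≃ Fin H.n, G.edges.map (Sym2.map (Sum.map id s)) = H.edges

theorem map_map {U V W : Type} (E : Multiset (Sym2 U)) (f : U → V) (g : V → W) :
    (E.map (Sym2.map f)).map (Sym2.map g) = E.map (Sym2.map (g ∘ f)) := by
  rw [Multiset.map_map, Sym2.map_comp]

theorem iso_equivalence : Equivalence (Iso (k := k)) where
  refl G := ⟨Equiv.refl _, by simp⟩
  symm := by
    rintro G H ⟨s, h⟩
    refine ⟨s.symm, ?_⟩
    rw [← h, map_map, Sum.map_comp_map]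
    simp
  trans := by
    rintro G H K ⟨s, h⟩ ⟨s', h'⟩
    refine ⟨s.trans s', ?_⟩
    rw [← h', ← h, map_map, Sum.map_comp_map]
    simp

instance setoid (k : ℕ) : Setoid (LabeledMultigraph k) := ⟨Iso, iso_equivalence⟩

theorem loopless_map {V W : Type} {E : Multiset (Sym2 V)} (hE : ∀ e ∈ E, ¬ e.IsDiag)
    {f : V → W} (hf : Function.Injective f) : ∀ e ∈ E.map (Sym2.map f), ¬ e.IsDiag := by
  intro e he
  obtain ⟨e', he', rfl⟩ := Multiset.mem_map.1 he
  rw [Sym2.isDiag_map hf]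
  exact hE e' he'

theorem inclL_injective (k n m : ℕ) :
    Function.Injective (Sum.map (id : Fin k → Fin k) (Fin.castAdd (n := n) m)) :=
  Function.Injective.sumMap Function.injective_id (Fin.castAdd_injective n m)

theorem inclR_injective (k n m : ℕ) :
    Function.Injective (Sum.map (id : Fin k → Fin k) (Fin.natAdd (m := m) n)) :=
  Function.Injective.sumMap Function.injective_id (Fin.natAdd_injective m n)

/-- The gluing product: the disjoint union with the vertices of equal label identified, and with
edge multiplicities added up. -/
def glue (G H : LabeledMultigraph k) : LabeledMultigraph k where
  n := G.n + H.n
  edges := G.edges.map (Sym2.map (Sum.map id (Fin.castAdd H.n))) +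
    H.edges.map (Sym2.map (Sum.map id (Fin.natAdd G.n)))
  loopless := by
    intro e he
    rcases Multiset.mem_add.1 he with he | he
    · exact loopless_map G.loopless (inclL_injective _ _ _) e he
    · exact loopless_map H.loopless (inclR_injective _ _ _) e he

/-- The multigraph with vertices labeled `1, …, k` and no edges. -/
def empty (k : ℕ) : LabeledMultigraph k := ⟨0, 0, by simp⟩

/-- The fully labeled multigraph whose only edge joins the (distinct) labels `i` and `j`. -/
def edge (i j : Fin k) (h : i ≠ j) : LabeledMultigraph k :=
  ⟨0, {s(Sum.inl i, Sum.inl j)}, by simpa using h⟩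

/-- Removing all labels, keeping the vertices and the edges. -/
def unlabel (G : LabeledMultigraph k) : LabeledMultigraph 0 where
  n := k + G.n
  edges := G.edges.map (Sym2.map (Sum.inr ∘ finSumFinEquiv))
  loopless := loopless_map G.loopless (Sum.inr_injective.comp finSumFinEquiv.injective)

/-- The unlabeled multigraph `K₁`: a single vertex. -/
def singleVertex : LabeledMultigraph 0 := ⟨1, 0, by simp⟩

/-- The unlabeled multigraph `K₂ᵐ`: two vertices with `m` edges between them. -/
def multiEdge (m : ℕ) : LabeledMultigraph 0 :=
  ⟨2, Multiset.replicate m s(Sum.inr 0, Sum.inr 1), by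
    intro e he
    rw [Multiset.eq_of_mem_replicate he]
    simp⟩

theorem map_map_eq {U V V' W : Type} (E : Multiset (Sym2 U)) {f : U → V} {g : V → W}
    {f' : U → V'} {g' : V' → W} (h : ∀ x, g (f x) = g' (f' x)) :
    (E.map (Sym2.map f)).map (Sym2.map g) = (E.map (Sym2.map f')).map (Sym2.map g') := by
  rw [map_map, map_map, show g ∘ f = g' ∘ f' from funext h]

theorem glue_iso {G G' H H' : LabeledMultigraph k} (hG : Iso G G') (hH : Iso H H') :
    Iso (glue G H) (glue G' H') := by
  obtain ⟨s, hs⟩ := hG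
  obtain ⟨u, hu⟩ := hH
  refine ⟨finSumFinEquiv.symm.trans ((Equiv.sumCongr s u).trans finSumFinEquiv),
    (Multiset.map_add _ _ _).trans (congrArg₂ (· + ·) ?_ ?_)⟩
  · rw [← hs]
    apply map_map_eq
    rintro (x | x)
    · rfl
    · exact congrArg Sum.inr (show finSumFinEquiv (Sum.map s u (finSumFinEquiv.symm
        (Fin.castAdd H.n x))) = Fin.castAdd H'.n (s x) by simp)
  · rw [← hu]
    apply map_map_eq
    rintro (x | x)
    · rfl
    · exact congrArg Sum.inr (show finSumFinEquiv (Sum.map s u (finSumFinEquiv.symm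
        (Fin.natAdd G.n x))) = Fin.natAdd G'.n (u x) by simp)

theorem glue_assoc (G H K : LabeledMultigraph k) :
    Iso (glue (glue G H) K) (glue G (glue H K)) := by
  refine ⟨finCongr (Nat.add_assoc _ _ _), ?_⟩
  unfold glue
  simp only [Multiset.map_add, map_map, add_assoc]
  refine congrArg₂ (· + ·) ?_ (congrArg₂ (· + ·) ?_ ?_) <;>
  · refine congrArg (fun f => Multiset.map (Sym2.map f) _) (funext ?_)
    rintro (x | x) <;> simp [Fin.ext_iff, Nat.add_assoc]

theorem glue_comm (G H : LabeledMultigraph k) : Iso (glue G H) (glue H G) := by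
  refine ⟨finAddFlip, (Multiset.map_add _ _ _).trans
    ((add_comm _ _).trans (congrArg₂ (· + ·) ?_ ?_))⟩
  · refine (map_map _ _ _).trans (congrArg (fun f => Multiset.map (Sym2.map f) _) (funext ?_))
    rintro (x | x)
    · rfl
    · exact congrArg Sum.inr (finAddFlip_apply_natAdd x G.n)
  · refine (map_map _ _ _).trans (congrArg (fun f => Multiset.map (Sym2.map f) _) (funext ?_))
    rintro (x | x)
    · rfl
    · exact congrArg Sum.inr (finAddFlip_apply_castAdd x H.n)

theorem empty_glue (G : LabeledMultigraph k) : Iso (glue (empty k) G) G := by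
  refine ⟨finCongr (Nat.zero_add _), (Multiset.map_add _ _ _).trans ((zero_add _).trans
    ((map_map _ _ _).trans ((congrArg (fun f => G.edges.map (Sym2.map f))
      (funext ?_ : _ = id)).trans (by simp))))⟩
  rintro (x | x)
  · rfl
  · exact congrArg Sum.inr (Fin.ext (Nat.zero_add _))

theorem unlabel_iso {G G' : LabeledMultigraph k} (hG : Iso G G') :
    Iso (unlabel G) (unlabel G') := by
  obtain ⟨s, hs⟩ := hG
  refine ⟨finSumFinEquiv.symm.trans
    ((Equiv.sumCongr (Equiv.refl _) s).trans finSumFinEquiv), ?_⟩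
  change (G.edges.map _).map _ = G'.edges.map _
  rw [← hs]
  apply map_map_eq
  rintro (x | x)
  · exact congrArg Sum.inr (show finSumFinEquiv (Sum.map id s (finSumFinEquiv.symm
      (finSumFinEquiv (Sum.inl x)))) = finSumFinEquiv (Sum.inl x) by simp)
  · exact congrArg Sum.inr (show finSumFinEquiv (Sum.map id s (finSumFinEquiv.symm
      (finSumFinEquiv (Sum.inr x)))) = finSumFinEquiv (Sum.inr (s x)) by simp)

end LabeledMultigraph

/-- The set of isomorphism classes of `k`-labeled multigraphs. -/
def GraphClass (k : ℕ) : Type := Quotient (LabeledMultigraph.setoid k)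

namespace GraphClass

variable {k : ℕ}

/-- The isomorphism class of a `k`-labeled multigraph. -/
def mk (G : LabeledMultigraph k) : GraphClass k := Quotient.mk _ G

/-- Isomorphism classes form a commutative monoid under the gluing product, with the edgeless
multigraph on the labeled vertices as its identity. For `k = 0` the product is the disjoint union
and the identity is the multigraph without vertices. -/
instance : CommMonoid (GraphClass k) where
  mul := Quotient.map₂ LabeledMultigraph.glue
    (fun _ _ h _ _ h' => LabeledMultigraph.glue_iso h h')
  one := mk (LabeledMultigraph.empty k)
  mul_assoc := by
    rintro ⟨G⟩ ⟨H⟩ ⟨K⟩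
    exact Quotient.sound (LabeledMultigraph.glue_assoc G H K)
  mul_comm := by
    rintro ⟨G⟩ ⟨H⟩
    exact Quotient.sound (LabeledMultigraph.glue_comm G H)
  one_mul := by
    rintro ⟨G⟩
    exact Quotient.sound (LabeledMultigraph.empty_glue G)
  mul_one := by
    rintro ⟨G⟩
    exact Quotient.sound (LabeledMultigraph.iso_equivalence.trans
      (LabeledMultigraph.glue_comm _ _) (LabeledMultigraph.empty_glue G))

/-- The number of unlabeled vertices. -/
def deg : GraphClass k → ℕ :=
  Quotient.lift LabeledMultigraph.n (fun _ _ h => h.elim fun s _ => by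
    simpa using Fintype.card_congr s)

theorem deg_one : deg (1 : GraphClass k) = 0 := rfl

theorem deg_mul (G H : GraphClass k) : deg (G * H) = deg G + deg H := by
  induction G using Quotient.inductionOn
  induction H using Quotient.inductionOn
  rfl

/-- Removing all labels. -/
def unlabel : GraphClass k → GraphClass 0 :=
  Quotient.map LabeledMultigraph.unlabel (fun _ _ h => LabeledMultigraph.unlabel_iso h)

end GraphClass

/-- The `k`-th graph algebra `𝒜ₖ`, the monoid algebra of the monoid of `k`-labeled multigraphs.
The elements of `GraphAlgebra 0` are the quantum multigraphs. -/
abbrev GraphAlgebra (k : ℕ) : Type := MonoidAlgebra ℝ (GraphClass k)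

namespace GraphAlgebra

variable {k : ℕ}

/-- The degree zero part `𝒜ₖ⁰` of `𝒜ₖ`: the linear combinations of fully labeled multigraphs. -/
def degZero (k : ℕ) : Subalgebra ℝ (GraphAlgebra k) where
  carrier := {a | ∀ G : GraphClass k, a.coeff G ≠ 0 → G.deg = 0}
  mul_mem' := by
    classical
    intro a b ha hb G hG
    obtain ⟨x, hx, y, hy, rfl⟩ := Finset.mem_mul.1
      (MonoidAlgebra.support_coeff_mul_subset a b (Finsupp.mem_support_iff.2 hG))
    rw [GraphClass.deg_mul, ha x (Finsupp.mem_support_iff.1 hx),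
      hb y (Finsupp.mem_support_iff.1 hy)]
  add_mem' := by
    intro a b ha hb G hG
    by_contra h
    have h1 : a.coeff G = 0 := by_contra fun h' => h (ha G h')
    have h2 : b.coeff G = 0 := by_contra fun h' => h (hb G h')
    exact hG (by simp [h1, h2])
  algebraMap_mem' := by
    classical
    intro c G hG
    by_contra h
    apply hG
    have : (1 : GraphClass k) ≠ G := fun h' => h (by rw [← h', GraphClass.deg_one])
    simp [this]

/-- The variable `zᵢⱼ` of `𝒜ₖ⁰`: the fully labeled multigraph whose only edge is `ij`. -/
noncomputable def z (i j : Fin k) (h : i ≠ j) : degZero k :=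
  ⟨MonoidAlgebra.single (GraphClass.mk (LabeledMultigraph.edge i j h)) 1, by
    classical
    intro G hG
    by_contra h'
    apply hG
    have : GraphClass.mk (LabeledMultigraph.edge i j h) ≠ G := fun e => h' (by rw [← e]; rfl)
    simp [this]⟩

/-- Removing all labels, as a linear map to the quantum multigraphs. -/
noncomputable def unlabel (k : ℕ) : GraphAlgebra k →ₗ[ℝ] GraphAlgebra 0 :=
  MonoidAlgebra.mapDomainLinearMap ℝ ℝ GraphClass.unlabel

/-- The span of all differences between an unlabeled multigraph with one more isolated vertex and
the multigraph itself. -/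
noncomputable def isolatedSpan : Submodule ℝ (GraphAlgebra 0) :=
  Submodule.span ℝ (Set.range fun G : GraphClass 0 =>
    (MonoidAlgebra.single (G * GraphClass.mk LabeledMultigraph.singleVertex) 1 -
      MonoidAlgebra.single G 1 : GraphAlgebra 0))

/-- The quantum multigraph `a` and the element `s` of `𝒜ₖ` coincide up to labels and isolated
vertices: removing the labels from `s` and adding or removing isolated vertices in the multigraphs
of the resulting linear combination leads to `a`. -/
def Coincide (a : GraphAlgebra 0) (s : GraphAlgebra k) : Prop :=
  a - unlabel k s ∈ isolatedSpan

end GraphAlgebra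

/-- The preorder generated by `r₁, …, rₘ` in a commutative ring: all sums over the subsets `S` of
the index set of a sum of squares times the product of the `rᵢ` with `i ∈ S`. -/
def preorderGenerated {R ι : Type*} [CommRing R] [Fintype ι] (r : ι → R) : Set R :=
  {x | ∃ s : Finset ι → R, (∀ S, IsSumSq (s S)) ∧ x = ∑ S : Finset ι, s S * ∏ i ∈ S, r i}

/-- The preorder `𝒫ₖ(d)` in `𝒜ₖ⁰` generated by all `d + zᵢⱼ` and all `d - zᵢⱼ` with `i < j`. -/
noncomputable def edgePreorder (k : ℕ) (d : ℝ) : Set (GraphAlgebra.degZero k) :=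
  preorderGenerated
    (Sum.elim
      (fun p : {p : Fin k × Fin k // p.1 < p.2} =>
        algebraMap ℝ (GraphAlgebra.degZero k) d + GraphAlgebra.z p.1.1 p.1.2 p.2.ne)
      (fun p : {p : Fin k × Fin k // p.1 < p.2} =>
        algebraMap ℝ (GraphAlgebra.degZero k) d - GraphAlgebra.z p.1.1 p.1.2 p.2.ne))

/-- A graph parameter: a real number for each unlabeled multigraph, up to isomorphism. -/
abbrev GraphParameter : Type := GraphClass 0 → ℝ

namespace GraphParameter

/-- The linear extension of a graph parameter to quantum multigraphs. -/
noncomputable def eval (t : GraphParameter) : GraphAlgebra 0 →ₗ[ℝ] ℝ :=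
  Finsupp.linearCombination ℝ t ∘ₗ (MonoidAlgebra.coeffLinearEquiv ℝ).toLinearMap

/-- The linear functional on `𝒜ₖ` defined by a graph parameter by ignoring the labels. -/
noncomputable def evalLabeled (t : GraphParameter) (k : ℕ) : GraphAlgebra k →ₗ[ℝ] ℝ :=
  t.eval ∘ₗ GraphAlgebra.unlabel k

/-- The value does not change when an isolated vertex is added. -/
def IsolateIndifferent (t : GraphParameter) : Prop :=
  ∀ G : GraphClass 0, t (G * GraphClass.mk LabeledMultigraph.singleVertex) = t G

/-- `t(b²) ≥ 0` for all `b` in `𝒜ₖ⁰` and all `k`. -/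
def FlatlyReflectionPositive (t : GraphParameter) : Prop :=
  ∀ k : ℕ, ∀ b ∈ GraphAlgebra.degZero k, 0 ≤ t.evalLabeled k (b ^ 2)

/-- `|t(K₂ᵐ)| ≤ dᵐ` for all `m`. -/
def IsBoundedBy (d : ℝ) (t : GraphParameter) : Prop :=
  ∀ m : ℕ, |t (GraphClass.mk (LabeledMultigraph.multiEdge m))| ≤ d ^ m

end GraphParameter

/-!
The quantum multigraphs that have a certificate, that is, that coincide up to labels and isolated
vertices with an element of some preorder `𝒫ₖ(d)`, form a convex cone, `certifiedCone d`: adding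
isolated labeled vertices maps `𝒫ₖ(d)` into `𝒫ₗ(d)` for `k ≤ l`, so two certificates can be brought
to a common `k` and added. The theorem says that the closure of this cone in the direction of the
identity is the dual cone of the graph parameters considered, and it rests on three facts.

*The cone is Archimedean.* If `w` is a monomial of degree `m` in the edge variables, then
`dᵐ + w` and `dᵐ - w` lie in the preorder (`pow_card_add_sub_monomial_mem_preorder`), and each
multigraph becomes such a monomial when all of its vertices are labeled (`coincide_monomial`).
Hence the identity is an order unit of the cone (`exists_smul_one_add_mem_certifiedCone`).

*The normalized functionals that are nonnegative on the cone are graph parameters of the required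
kind.* The cone contains the subspace spanned by the differences `G' - G`, which gives isolate
indifference; it contains the squares of fully labeled elements with the labels removed, which gives
flat reflection positivity; and the bounds on monomials give `d`-boundedness. If `a + ε` is not in
the cone, the Riesz extension theorem provides such a functional with value at most `0` at `a + ε`
(`PointedCone.exists_apply_nonpos_of_notMem`), so with a negative value at `a`.

*Conversely, each such graph parameter is nonnegative on the preorders*
(`GraphParameter.evalLabeled_nonneg_of_mem_edgePreorder`). Let `L` be the induced functional on
`𝒜ₖ⁰`. It is nonnegative on squares and `|L(zᵢⱼᵐ)| ≤ dᵐ`. Iterating the Cauchy–Schwarz inequality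
along the exponents `2ⁿ` improves the growth bound to `|L(b² zᵢⱼ)| ≤ d L(b²)`
(`apply_sq_mul_add_nonneg`), which is positivity on `b² (d ± zᵢⱼ)`. The functional
`x ↦ L(x (d ± zᵢⱼ))` is again nonnegative on squares and its even moments grow no faster, so
products of several generators are dealt with by induction (`apply_sq_mul_prod_nonneg`).
-/

/-! ### The generated preorder -/

section Preorder

variable {R ι : Type*} [CommRing R] [Fintype ι]

theorem IsSumSq.mul_prod_mem_preorderGenerated (r : ι → R) {s : R} (hs : IsSumSq s)
    (S : Finset ι) : s * ∏ i ∈ S, r i ∈ preorderGenerated r := by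
  classical
  refine ⟨fun T => if T = S then s else 0, fun T => ?_, ?_⟩
  · dsimp only
    split_ifs
    · exact hs
    · exact IsSumSq.zero
  · simp

theorem zero_mem_preorderGenerated (r : ι → R) : 0 ∈ preorderGenerated r :=
  ⟨0, fun _ => IsSumSq.zero, by simp⟩

theorem add_mem_preorderGenerated {r : ι → R} {x y : R} (hx : x ∈ preorderGenerated r)
    (hy : y ∈ preorderGenerated r) : x + y ∈ preorderGenerated r := by
  obtain ⟨s, hs, rfl⟩ := hx
  obtain ⟨u, hu, rfl⟩ := hy
  exact ⟨s + u, fun S => (hs S).add (hu S), by simp [add_mul, Finset.sum_add_distrib]⟩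

/-- The preorder generated by `r`, as a subsemiring. It is closed under multiplication because
the product of `∏ i ∈ S, r i` and `∏ i ∈ T, r i` is the product over the symmetric difference of
`S` and `T`, times the square of the product over `S ∩ T`. -/
def preorderSubsemiring (r : ι → R) : Subsemiring R where
  carrier := preorderGenerated r
  zero_mem' := zero_mem_preorderGenerated r
  one_mem' := by
    simpa using IsSumSq.mul_prod_mem_preorderGenerated r (IsSumSq.one (R := R)) ∅
  add_mem' := add_mem_preorderGenerated
  mul_mem' := by
    classical
    rintro _ _ ⟨s, hs, rfl⟩ ⟨u, hu, rfl⟩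
    rw [Finset.sum_mul_sum]
    refine Finset.sum_induction _ (· ∈ preorderGenerated r)
      (fun _ _ => add_mem_preorderGenerated) (zero_mem_preorderGenerated r) fun S _ =>
      Finset.sum_induction _ (· ∈ preorderGenerated r)
        (fun _ _ => add_mem_preorderGenerated) (zero_mem_preorderGenerated r) fun T _ => ?_
    have key : (∏ i ∈ S, r i) * ∏ i ∈ T, r i =
        (∏ i ∈ S ∩ T, r i) * (∏ i ∈ S ∩ T, r i) * ∏ i ∈ (S \ T) ∪ (T \ S), r i := by
      rw [Finset.prod_union (disjoint_sdiff_sdiff : Disjoint (S \ T) (T \ S)),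
        ← Finset.prod_inter_mul_prod_sdiff S T r, ← Finset.prod_inter_mul_prod_sdiff T S r,
        Finset.inter_comm T S]
      ring
    have : s S * (∏ i ∈ S, r i) * (u T * ∏ i ∈ T, r i) =
        s S * u T * ((∏ i ∈ S ∩ T, r i) * (∏ i ∈ S ∩ T, r i)) *
          ∏ i ∈ (S \ T) ∪ (T \ S), r i := by
      rw [mul_mul_mul_comm, key, ← mul_assoc]
    rw [this]
    exact IsSumSq.mul_prod_mem_preorderGenerated r
      (((hs S).mul (hu T)).mul (IsSumSq.mul_self _)) _

theorem mem_preorderSubsemiring {r : ι → R} {x : R} :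
    x ∈ preorderSubsemiring r ↔ x ∈ preorderGenerated r := Iff.rfl

theorem IsSumSq.mem_preorderSubsemiring (r : ι → R) {s : R} (hs : IsSumSq s) :
    s ∈ preorderSubsemiring r := by
  rw [_root_.mem_preorderSubsemiring]
  simpa using IsSumSq.mul_prod_mem_preorderGenerated r hs ∅

theorem generator_mem_preorderSubsemiring (r : ι → R) (i : ι) :
    r i ∈ preorderSubsemiring r := by
  rw [mem_preorderSubsemiring]
  simpa using IsSumSq.mul_prod_mem_preorderGenerated r (IsSumSq.one (R := R)) {i}

theorem smul_mem_preorderSubsemiring [Algebra ℝ R] (r : ι → R) {c : ℝ} (hc : 0 ≤ c) {x : R}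
    (hx : x ∈ preorderSubsemiring r) : c • x ∈ preorderSubsemiring r := by
  rw [Algebra.smul_def, ← Real.mul_self_sqrt hc, map_mul]
  exact mul_mem ((IsSumSq.mul_self _).mem_preorderSubsemiring r) hx

/-- The preorder generated by `r` is the least subsemiring that contains all squares and `r`. -/
theorem preorderSubsemiring_le {r : ι → R} {P : Subsemiring R} (hsq : ∀ x, x * x ∈ P)
    (hr : ∀ i, r i ∈ P) : preorderSubsemiring r ≤ P := by
  rintro _ ⟨s, hs, rfl⟩
  refine sum_mem fun S _ => mul_mem ?_ (prod_mem fun i _ => hr i)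
  have h := hs S
  generalize s S = x at h ⊢
  induction h with
  | zero => exact zero_mem P
  | sq_add a _ ih => exact add_mem (hsq a) ih

end Preorder

/-! ### Positive functionals with bounded even moments -/

section PositiveFunctional

variable {R : Type*} [CommRing R] [Algebra ℝ R] {L : R →ₗ[ℝ] ℝ}

/-- The Cauchy–Schwarz inequality for a functional that is nonnegative on squares. -/
theorem sq_apply_mul_le (hL : ∀ b, 0 ≤ L (b ^ 2)) (a b : R) :
    L (a * b) ^ 2 ≤ L (a ^ 2) * L (b ^ 2) := by
  have h := discrim_le_zero (a := L (a ^ 2)) (b := 2 * L (a * b)) (c := L (b ^ 2)) fun x => by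
    have hx := hL (x • a + b)
    have : (x • a + b) ^ 2 = (x * x) • a ^ 2 + (2 * x) • (a * b) + b ^ 2 := by
      simp only [Algebra.smul_def, map_mul, map_ofNat]
      ring
    rw [this] at hx
    simp only [map_add, map_smul, smul_eq_mul] at hx
    linarith
  rw [discrim] at h
  linarith

/-- If the powers of `y` with exponent a power of two grow at most like those of `x ≥ 0`, then
`y ≤ x`. -/
theorem le_of_forall_pow_two_pow_le {x y C : ℝ} (hx : 0 ≤ x)
    (h : ∀ n : ℕ, y ^ 2 ^ n ≤ C * x ^ 2 ^ n) : y ≤ x := by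
  by_contra! hxy
  rcases hx.eq_or_lt with rfl | hx
  · have := h 0
    simp at this
    linarith
  · obtain ⟨n, hn⟩ := pow_unbounded_of_one_lt C ((one_lt_div hx).2 hxy)
    have h1 : (y / x) ^ n ≤ (y / x) ^ 2 ^ n :=
      pow_le_pow_right₀ ((one_lt_div hx).2 hxy).le Nat.lt_two_pow_self.le
    have h2 := h n
    rw [← div_le_iff₀ (by positivity), ← div_pow] at h2
    linarith

/-- A functional that is nonnegative on squares, and whose even moments of `z` are bounded by a
multiple of the powers of `d`, is nonnegative on the elements `b ^ 2 * (d + z)`: iterating the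
Cauchy–Schwarz inequality bounds `|L (b ^ 2 * z)|` by `d * L (b ^ 2)`. -/
theorem apply_sq_mul_add_nonneg (hL : ∀ b, 0 ≤ L (b ^ 2)) {d : ℝ} (hd : 0 ≤ d) {z : R}
    (hz : ∃ C, ∀ m : ℕ, L (z ^ (2 * m)) ≤ C * d ^ (2 * m)) (b : R) :
    0 ≤ L (b ^ 2 * (algebraMap ℝ R d + z)) := by
  obtain ⟨C, hC⟩ := hz
  set u := L (b ^ 2) with hu
  have cs : ∀ m : ℕ, L (b ^ 2 * z ^ m) ^ 2 ≤ u * L (b ^ 2 * z ^ (2 * m)) := fun m => by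
    have := sq_apply_mul_le hL b (b * z ^ m)
    rwa [← mul_assoc, ← sq, mul_pow, ← pow_mul, mul_comm m] at this
  have expand : L (b ^ 2 * (algebraMap ℝ R d + z)) = d * u + L (b ^ 2 * z) := by
    rw [mul_add, map_add, mul_comm (b ^ 2), ← Algebra.smul_def, map_smul, smul_eq_mul]
  rw [expand]
  suffices h : |L (b ^ 2 * z)| ≤ d * u by linarith [neg_abs_le (L (b ^ 2 * z))]
  have hu0 : 0 ≤ u := hL b
  rcases hu0.eq_or_lt with h0 | h0
  · have := cs 1
    rw [← h0, zero_mul, pow_one] at this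
    rw [← h0, pow_eq_zero_iff two_ne_zero |>.1 (le_antisymm this (sq_nonneg _))]
    simp
  set y := |L (b ^ 2 * z)| / u with hy
  have hy0 : 0 ≤ y := by positivity
  have iter : ∀ n : ℕ, u * y ^ 2 ^ n ≤ |L (b ^ 2 * z ^ 2 ^ n)| := fun n => by
    induction n with
    | zero => simp [hy, mul_div_cancel₀ _ h0.ne']
    | succ n ih =>
      have h1 : (u * y ^ 2 ^ n) ^ 2 ≤ L (b ^ 2 * z ^ 2 ^ n) ^ 2 := by
        rw [← sq_abs (L _)]
        gcongr
      have h2 := h1.trans (cs _)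
      rw [mul_pow, sq u, mul_assoc, ← pow_mul, ← pow_succ] at h2
      rw [mul_comm 2, ← pow_succ] at h2
      exact (le_of_mul_le_mul_left h2 h0).trans (le_abs_self _)
  have hyd : y ^ 2 ≤ d ^ 2 := by
    refine le_of_forall_pow_two_pow_le (C := L ((b ^ 2) ^ 2) * C / u ^ 2) (sq_nonneg d) fun n => ?_
    rw [div_mul_eq_mul_div, le_div_iff₀ (by positivity)]
    calc (y ^ 2) ^ 2 ^ n * u ^ 2 = (u * y ^ 2 ^ n) ^ 2 := by ring
      _ ≤ L (b ^ 2 * z ^ 2 ^ n) ^ 2 := by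
        rw [← sq_abs (L _)]
        have := iter n
        gcongr
      _ ≤ L ((b ^ 2) ^ 2) * L ((z ^ 2 ^ n) ^ 2) := sq_apply_mul_le hL _ _
      _ ≤ L ((b ^ 2) ^ 2) * (C * d ^ (2 * 2 ^ n)) := by
        have := hC (2 ^ n)
        rw [← pow_mul z, mul_comm (2 ^ n) 2]
        exact mul_le_mul_of_nonneg_left this (hL _)
      _ = L ((b ^ 2) ^ 2) * C * (d ^ 2) ^ 2 ^ n := by rw [pow_mul, mul_assoc]
  have := abs_le_of_sq_le_sq hyd hd
  rw [abs_le] at this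
  exact (div_le_iff₀ h0).1 this.2

/-- A functional that is nonnegative on squares and has bounded even moments is nonnegative on
the products of a square with factors `d + z i`: the functional `x ↦ L (x * (d + z j))` satisfies
the same hypotheses, so the factors can be split off one at a time. -/
theorem apply_sq_mul_prod_nonneg {ι : Type*} {d : ℝ} (hd : 0 ≤ d) (z : ι → R) (S : Finset ι) :
    ∀ L : R →ₗ[ℝ] ℝ, (∀ b, 0 ≤ L (b ^ 2)) →
      (∀ i, ∃ C, ∀ m : ℕ, L (z i ^ (2 * m)) ≤ C * d ^ (2 * m)) →
      ∀ b, 0 ≤ L (b ^ 2 * ∏ i ∈ S, (algebraMap ℝ R d + z i)) := by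
  classical
  induction S using Finset.induction_on with
  | empty =>
    intro L hL _ b
    simpa using hL b
  | insert j S hj ih =>
    intro L hL hz b
    have := ih (L ∘ₗ LinearMap.mulRight ℝ (algebraMap ℝ R d + z j))
      (fun b => apply_sq_mul_add_nonneg hL hd (hz j) b) (fun i => ?_) b
    · rw [Finset.prod_insert hj]
      simpa [mul_assoc, mul_comm, mul_left_comm] using this
    · obtain ⟨C, hC⟩ := hz i
      set r := algebraMap ℝ R d + z j
      -- by Cauchy–Schwarz, `L (z i ^ (2 * m) * r) ^ 2 ≤ L (z i ^ (4 * m)) * L (r ^ 2)`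
      refine ⟨√(L (r ^ 2) * C), fun m => ?_⟩
      have h1 := sq_apply_mul_le hL (z i ^ (2 * m)) r
      rw [← pow_mul, mul_assoc, mul_comm (L _)] at h1
      have h2 := h1.trans (mul_le_mul_of_nonneg_left (hC (m * 2)) (hL r))
      rw [← mul_assoc, ← mul_assoc 2, pow_mul d] at h2
      have h3 := Real.abs_le_sqrt h2
      rw [Real.sqrt_mul' _ (sq_nonneg _), Real.sqrt_sq (by positivity)] at h3
      exact (le_abs_self _).trans h3

end PositiveFunctional

/-! ### Separation from an Archimedean cone -/

/-- A point outside a convex cone with order unit `e` is separated from the cone by a functional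
that takes the value `1` at `e`. -/
theorem PointedCone.exists_apply_nonpos_of_notMem {E : Type*} [AddCommGroup E] [Module ℝ E]
    (K : PointedCone ℝ E) {e : E} (he : e ∈ K) (hK : ∀ x, ∃ N : ℝ, N • e + x ∈ K)
    {x : E} (hx : x ∉ K) :
    ∃ g : E →ₗ[ℝ] ℝ, g e = 1 ∧ (∀ y ∈ K, 0 ≤ g y) ∧ g x ≤ 0 := by
  have smul_mem : ∀ {c : ℝ}, 0 ≤ c → ∀ {y}, y ∈ K → c • y ∈ K := fun {c} hc {y} hy =>
    Submodule.smul_mem K (⟨c, hc⟩ : NNReal) hy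
  have hneg : -e ∉ K := fun h => by
    obtain ⟨N, hN⟩ := hK x
    apply hx
    have := K.add_mem (K.add_mem hN (smul_mem (abs_nonneg N) h))
      (smul_mem (sub_nonneg.2 (le_abs_self N)) he)
    convert this using 1
    module
  have he0 : e ≠ 0 := fun h => hneg (by simp [h])
  -- the separating functional is nonnegative on the cone generated by `K` and `-x`
  set K' : PointedCone ℝ E := K ⊔ Submodule.span _ {-x} with hK'
  have hK'_neg : -e ∉ K' := fun h => by
    obtain ⟨y, hy, w, hw, hyw⟩ := Submodule.mem_sup.1 h
    obtain ⟨c, rfl⟩ := Submodule.mem_span_singleton.1 hw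
    have hyw : y + (c : ℝ) • (-x) = -e := hyw
    rcases c.2.eq_or_lt with hc | hc
    · have hc : (c : ℝ) = 0 := hc.symm
      rw [hc, zero_smul, add_zero] at hyw
      exact hneg (hyw ▸ hy)
    · have hc : 0 < (c : ℝ) := hc
      have h1 : (c : ℝ) • x = y + e := by
        rw [smul_neg, ← sub_eq_add_neg, sub_eq_iff_eq_add] at hyw
        rw [hyw]
        abel
      apply hx
      rw [← inv_smul_smul₀ hc.ne' x, h1]
      exact smul_mem (inv_nonneg.2 hc.le) (K.add_mem hy he)
  have hle : K ≤ K' := le_sup_left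
  obtain ⟨g, hg, hgK⟩ := riesz_extension K' (LinearPMap.mkSpanSingleton e (1 : ℝ) he0)
    (by
      rintro ⟨y, hy⟩ hyK
      obtain ⟨c, rfl⟩ := Submodule.mem_span_singleton.1 hy
      rw [LinearPMap.mkSpanSingleton'_apply]
      by_contra! hc
      have hc' : c < 0 := by simpa using hc
      apply hK'_neg
      have := Submodule.smul_mem K' (⟨(-c)⁻¹, by simpa using hc'.le⟩ : NNReal) hyK
      change (-c)⁻¹ • (c • e) ∈ K' at this
      rwa [smul_smul, inv_neg, neg_mul, inv_mul_cancel₀ hc'.ne, neg_one_smul] at this)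
    (fun y => by
      obtain ⟨N, hN⟩ := hK y
      exact ⟨⟨N • e, Submodule.mem_span_singleton.2 ⟨N, rfl⟩⟩, hle hN⟩)
  refine ⟨g, ?_, fun y hy => hgK y (hle hy), ?_⟩
  · have := hg ⟨e, Submodule.mem_span_singleton_self e⟩
    rw [this]
    exact LinearPMap.mkSpanSingleton'_apply_self e 1 _ _
  · have := hgK (-x) (Submodule.mem_sup_right (Submodule.mem_span_singleton_self _))
    rw [map_neg] at this
    linarith

/-! ### Isolated vertices -/

namespace GraphClass

theorem mk_edgeless (r : ℕ) (h : ∀ e ∈ (0 : Multiset (Sym2 (Fin 0 ⊕ Fin r))), ¬ e.IsDiag) :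
    mk ⟨r, 0, h⟩ = mk LabeledMultigraph.singleVertex ^ r := by
  induction r with
  | zero => rfl
  | succ r ih =>
    rw [pow_succ, ← ih (by simp)]
    rfl

/-- If `f` embeds the vertices of `H` into those of `H'` and carries the edges of `H` to the
edges of `H'`, then `H'` arises from `H` by adding isolated vertices. -/
theorem exists_mk_eq_mul_pow {H H' : LabeledMultigraph 0} {f : Fin H.n → Fin H'.n}
    (hf : Function.Injective f)
    (hE : H.edges.map (Sym2.map (Sum.map id f)) = H'.edges) :
    ∃ r : ℕ, mk H' = mk H * mk LabeledMultigraph.singleVertex ^ r := by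
  classical
  refine ⟨Fintype.card ↥(Set.range f)ᶜ, ?_⟩
  rw [← mk_edgeless _ (by simp)]
  refine Eq.symm (Quotient.sound (s := LabeledMultigraph.setoid 0) ?_)
  refine ⟨finSumFinEquiv.symm.trans
    ((Equiv.sumCongr (Equiv.ofInjective f hf) (Fintype.equivFin _).symm).trans
      (Equiv.Set.sumCompl (Set.range f))), ?_⟩
  rw [← hE]
  refine (Multiset.map_add _ _ _).trans ((add_zero _).trans ?_)
  refine (LabeledMultigraph.map_map _ _ _).trans
    (congrArg (fun g => Multiset.map (Sym2.map g) _) (funext ?_))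
  rintro (x | x)
  · exact x.elim0
  · refine congrArg Sum.inr (show Equiv.Set.sumCompl (Set.range f) (Sum.map
      (Equiv.ofInjective f hf) (Fintype.equivFin _).symm (finSumFinEquiv.symm
        (Fin.castAdd _ x))) = f x from ?_)
    rw [finSumFinEquiv_symm_apply_castAdd]
    rfl

end GraphClass

namespace GraphAlgebra

theorem single_mul_pow_sub_single_mem (G : GraphClass 0) (r : ℕ) :
    (MonoidAlgebra.single (G * GraphClass.mk LabeledMultigraph.singleVertex ^ r) 1 -
      MonoidAlgebra.single G 1 : GraphAlgebra 0) ∈ isolatedSpan := by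
  induction r with
  | zero => simp
  | succ r ih =>
    rw [pow_succ, ← mul_assoc]
    have := Submodule.subset_span (R := ℝ) (Set.mem_range_self
      (f := fun G : GraphClass 0 =>
        (MonoidAlgebra.single (G * GraphClass.mk LabeledMultigraph.singleVertex) 1 -
          MonoidAlgebra.single G 1 : GraphAlgebra 0))
      (G * GraphClass.mk LabeledMultigraph.singleVertex ^ r))
    rw [← sub_add_sub_cancel]
    exact add_mem this ih

theorem single_sub_single_mem_isolatedSpan {H H' : LabeledMultigraph 0} {f : Fin H.n → Fin H'.n}
    (hf : Function.Injective f) (hE : H.edges.map (Sym2.map (Sum.map id f)) = H'.edges) :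
    (MonoidAlgebra.single (GraphClass.mk H') 1 - MonoidAlgebra.single (GraphClass.mk H) 1 :
      GraphAlgebra 0) ∈ isolatedSpan := by
  obtain ⟨r, hr⟩ := GraphClass.exists_mk_eq_mul_pow hf hE
  rw [hr]
  exact single_mul_pow_sub_single_mem _ r

@[simp]
theorem unlabel_single {k : ℕ} (G : GraphClass k) (c : ℝ) :
    unlabel k (MonoidAlgebra.single G c) = MonoidAlgebra.single G.unlabel c :=
  MonoidAlgebra.mapDomainLinearMap_single _ _ _

end GraphAlgebra

/-! ### Adding labels -/

namespace LabeledMultigraph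

variable {k l : ℕ}

theorem castLE_sumMap_injective (h : k ≤ l) (n : ℕ) :
    Function.Injective (Sum.map (Fin.castLE h) (id : Fin n → Fin n)) :=
  (Fin.castLE_injective h).sumMap Function.injective_id

/-- Adding isolated vertices with the labels `k + 1, …, l` to a `k`-labeled multigraph. -/
def addLabels (h : k ≤ l) (G : LabeledMultigraph k) : LabeledMultigraph l where
  n := G.n
  edges := G.edges.map (Sym2.map (Sum.map (Fin.castLE h) id))
  loopless := loopless_map G.loopless (castLE_sumMap_injective h G.n)

theorem addLabels_iso (h : k ≤ l) {G H : LabeledMultigraph k} (hGH : Iso G H) :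
    Iso (addLabels h G) (addLabels h H) := by
  obtain ⟨s, hs⟩ := hGH
  refine ⟨s, ?_⟩
  change (G.edges.map _).map _ = H.edges.map _
  rw [← hs]
  apply map_map_eq
  rintro (x | x) <;> rfl

theorem addLabels_glue (h : k ≤ l) (G H : LabeledMultigraph k) :
    Iso (addLabels h (glue G H)) (glue (addLabels h G) (addLabels h H)) := by
  refine ⟨Equiv.refl (Fin (G.n + H.n)), ?_⟩
  unfold addLabels glue
  simp only [Multiset.map_add, map_map]
  refine congrArg₂ (· + ·) ?_ ?_ <;>
  · refine congrArg (fun f => Multiset.map (Sym2.map f) _) (funext ?_)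
    rintro (x | x) <;> rfl

end LabeledMultigraph

namespace GraphClass

variable {k l : ℕ}

/-- Adding isolated vertices with the labels `k + 1, …, l`, as a monoid homomorphism. -/
def addLabels (h : k ≤ l) : GraphClass k →* GraphClass l where
  toFun := Quotient.map (LabeledMultigraph.addLabels h)
    fun _ _ hGH => LabeledMultigraph.addLabels_iso h hGH
  map_one' := rfl
  map_mul' := by
    rintro ⟨G⟩ ⟨H⟩
    exact Quotient.sound (LabeledMultigraph.addLabels_glue h G H)

theorem deg_addLabels (h : k ≤ l) (G : GraphClass k) : (addLabels h G).deg = G.deg := by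
  induction G using Quotient.inductionOn
  rfl

end GraphClass

namespace GraphAlgebra

variable {k l : ℕ}

theorem single_mem_degZero {G : GraphClass k} (hG : G.deg = 0) (c : ℝ) :
    (MonoidAlgebra.single G c : GraphAlgebra k) ∈ degZero k := by
  classical
  intro H hH
  by_contra h
  apply hH
  rw [MonoidAlgebra.coeff_single, Finsupp.single_apply, if_neg]
  rintro rfl
  exact h hG

/-- Adding isolated labeled vertices, as a homomorphism of the algebras of fully labeled
multigraphs. -/
noncomputable def addLabels (h : k ≤ l) : degZero k →ₐ[ℝ] degZero l :=
  ((MonoidAlgebra.mapDomainAlgHom ℝ ℝ (GraphClass.addLabels h)).comp (degZero k).val).codRestrict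
    (degZero l) fun a G hG => by
      classical
      have hG' : G ∈ (Finsupp.mapDomain (GraphClass.addLabels h)
          (a : GraphAlgebra k).coeff).support := Finsupp.mem_support_iff.2 hG
      obtain ⟨H, hH, rfl⟩ := Finset.mem_image.1 (Finsupp.mapDomain_support hG')
      rw [GraphClass.deg_addLabels]
      exact a.2 H (Finsupp.mem_support_iff.1 hH)

theorem coe_addLabels (h : k ≤ l) (a : degZero k) :
    (addLabels h a : GraphAlgebra l) =
      MonoidAlgebra.mapDomainLinearMap ℝ ℝ (GraphClass.addLabels h) (a : GraphAlgebra k) := rfl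

theorem addLabels_z (h : k ≤ l) (i j : Fin k) (hij : i ≠ j) :
    addLabels h (z i j hij) =
      z (Fin.castLE h i) (Fin.castLE h j) ((Fin.castLE_injective h).ne hij) := by
  apply Subtype.ext
  rw [coe_addLabels]
  exact MonoidAlgebra.mapDomainLinearMap_single _ _ _

theorem unlabel_addLabels_sub_unlabel_mem (h : k ≤ l) (a : degZero k) :
    unlabel l (addLabels h a) - unlabel k a ∈ isolatedSpan := by
  rw [coe_addLabels]
  induction (a : GraphAlgebra k) using MonoidAlgebra.induction_linear with
  | zero => simp
  | add x y hx hy =>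
    rw [map_add, map_add, map_add, add_sub_add_comm]
    exact add_mem hx hy
  | single G c =>
    rw [MonoidAlgebra.mapDomainLinearMap_single, unlabel_single, unlabel_single,
      ← mul_one c, ← smul_eq_mul, ← MonoidAlgebra.smul_single, ← MonoidAlgebra.smul_single,
      ← smul_sub]
    refine Submodule.smul_mem _ _ ?_
    induction G using Quotient.inductionOn with
    | _ G =>
    refine single_sub_single_mem_isolatedSpan (H := G.unlabel) (H' := (G.addLabels h).unlabel)
      (f := finSumFinEquiv ∘ Sum.map (Fin.castLE h) id ∘ finSumFinEquiv.symm) ?_ ?_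
    · exact finSumFinEquiv.injective.comp
        ((LabeledMultigraph.castLE_sumMap_injective h G.n).comp finSumFinEquiv.symm.injective)
    · change (G.edges.map _).map _ = (G.edges.map _).map _
      apply LabeledMultigraph.map_map_eq
      intro x
      exact congrArg Sum.inr (show finSumFinEquiv (Sum.map (Fin.castLE h) id
        (finSumFinEquiv.symm (finSumFinEquiv x))) = _ by
          rw [Equiv.symm_apply_apply]
          rfl)

end GraphAlgebra

/-! ### Monomials in the edge variables -/

namespace GraphClass

variable {k : ℕ}

theorem mk_cons_edge {i j : Fin k} (hij : i ≠ j) (E : Multiset (Sym2 (Fin k ⊕ Fin 0)))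
    (hE : ∀ e ∈ s(Sum.inl i, Sum.inl j) ::ₘ E, ¬ e.IsDiag) :
    mk ⟨0, s(Sum.inl i, Sum.inl j) ::ₘ E, hE⟩ =
      mk ⟨0, E, fun e he => hE e (Multiset.mem_cons_of_mem he)⟩ *
        mk (LabeledMultigraph.edge i j hij) := by
  refine Eq.symm (Quotient.sound (s := LabeledMultigraph.setoid k) ⟨Equiv.refl (Fin 0), ?_⟩)
  refine (Multiset.map_add _ _ _).trans ((congrArg₂ (· + ·) ?_ rfl).trans
    ((add_comm _ _).trans (Multiset.singleton_add _ _)))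
  refine (LabeledMultigraph.map_map _ _ _).trans
    ((congrArg (fun g => Multiset.map (Sym2.map g) E) (funext ?_ : _ = id)).trans (by simp))
  rintro (x | x)
  · rfl
  · exact x.elim0

theorem mk_edge_pow {i j : Fin k} (hij : i ≠ j) (m : ℕ)
    (hE : ∀ e ∈ Multiset.replicate m s(Sum.inl i, Sum.inl j), ¬ e.IsDiag) :
    mk (LabeledMultigraph.edge i j hij) ^ m =
      mk ⟨0, Multiset.replicate m s(Sum.inl i, Sum.inl j), hE⟩ := by
  induction m with
  | zero => rfl
  | succ m ih =>
    have h := mk_cons_edge hij (Multiset.replicate m s(Sum.inl i, Sum.inl j))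
      (by rwa [← Multiset.replicate_succ])
    rw [pow_succ, ih]
    exact h.symm

end GraphClass

namespace GraphAlgebra

variable {k : ℕ}

/-- The element of `𝒜ₖ⁰` given by a fully labeled multigraph. -/
noncomputable def monomial (E : Multiset (Sym2 (Fin k ⊕ Fin 0))) (hE : ∀ e ∈ E, ¬ e.IsDiag) :
    degZero k :=
  ⟨MonoidAlgebra.single (GraphClass.mk ⟨0, E, hE⟩) 1, single_mem_degZero rfl 1⟩

theorem monomial_zero (hE : ∀ e ∈ (0 : Multiset (Sym2 (Fin k ⊕ Fin 0))), ¬ e.IsDiag) :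
    monomial 0 hE = 1 := rfl

theorem monomial_cons {i j : Fin k} (hij : i ≠ j) (E : Multiset (Sym2 (Fin k ⊕ Fin 0)))
    (hE : ∀ e ∈ s(Sum.inl i, Sum.inl j) ::ₘ E, ¬ e.IsDiag) :
    monomial (s(Sum.inl i, Sum.inl j) ::ₘ E) hE =
      monomial E (fun e he => hE e (Multiset.mem_cons_of_mem he)) * z i j hij := by
  apply Subtype.ext
  change MonoidAlgebra.single _ _ = MonoidAlgebra.single _ _ * MonoidAlgebra.single _ _
  rw [MonoidAlgebra.single_mul_single, mul_one, GraphClass.mk_cons_edge hij]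

theorem coe_z_pow (i j : Fin k) (hij : i ≠ j) (m : ℕ) :
    ((z i j hij ^ m : degZero k) : GraphAlgebra k) =
      MonoidAlgebra.single (GraphClass.mk (LabeledMultigraph.edge i j hij) ^ m) 1 := by
  change MonoidAlgebra.single _ _ ^ m = _
  rw [MonoidAlgebra.single_pow, one_pow]

theorem z_comm (i j : Fin k) (hij : i ≠ j) : z i j hij = z j i hij.symm := by
  have : LabeledMultigraph.edge i j hij = LabeledMultigraph.edge j i hij.symm := by
    simp [LabeledMultigraph.edge, Sym2.eq_swap]
  unfold z
  congr 3

end GraphAlgebra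

/-! ### The preorder of the edge variables -/

section EdgePreorder

variable {k l : ℕ}

open GraphAlgebra

/-- The generators `d + zᵢⱼ` and `d - zᵢⱼ` of `𝒫ₖ(d)`. -/
noncomputable abbrev edgeGenerators (k : ℕ) (d : ℝ) :
    {p : Fin k × Fin k // p.1 < p.2} ⊕ {p : Fin k × Fin k // p.1 < p.2} → degZero k :=
  Sum.elim (fun p => algebraMap ℝ (degZero k) d + z p.1.1 p.1.2 p.2.ne)
    (fun p => algebraMap ℝ (degZero k) d - z p.1.1 p.1.2 p.2.ne)

theorem mem_edgePreorder {d : ℝ} {x : degZero k} :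
    x ∈ edgePreorder k d ↔ x ∈ preorderSubsemiring (edgeGenerators k d) := Iff.rfl

theorem add_z_mem_preorder (d : ℝ) (i j : Fin k) (hij : i ≠ j) :
    algebraMap ℝ (degZero k) d + z i j hij ∈ preorderSubsemiring (edgeGenerators k d) := by
  rcases hij.lt_or_gt with h | h
  · exact generator_mem_preorderSubsemiring (edgeGenerators k d) (Sum.inl ⟨(i, j), h⟩)
  · rw [z_comm]
    exact generator_mem_preorderSubsemiring (edgeGenerators k d) (Sum.inl ⟨(j, i), h⟩)

theorem sub_z_mem_preorder (d : ℝ) (i j : Fin k) (hij : i ≠ j) :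
    algebraMap ℝ (degZero k) d - z i j hij ∈ preorderSubsemiring (edgeGenerators k d) := by
  rcases hij.lt_or_gt with h | h
  · exact generator_mem_preorderSubsemiring (edgeGenerators k d) (Sum.inr ⟨(i, j), h⟩)
  · rw [z_comm]
    exact generator_mem_preorderSubsemiring (edgeGenerators k d) (Sum.inr ⟨(j, i), h⟩)

theorem addLabels_mem_preorder (h : k ≤ l) {d : ℝ} {x : degZero k}
    (hx : x ∈ preorderSubsemiring (edgeGenerators k d)) :
    addLabels h x ∈ preorderSubsemiring (edgeGenerators l d) := by
  refine preorderSubsemiring_le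
    (P := (preorderSubsemiring (edgeGenerators l d)).comap (addLabels h).toRingHom)
    (fun x => ?_) ?_ hx
  · rw [Subsemiring.mem_comap, map_mul]
    exact (IsSumSq.mul_self _).mem_preorderSubsemiring _
  · rintro (p | p)
    · change addLabels h (algebraMap ℝ _ d + z p.1.1 p.1.2 p.2.ne) ∈
        preorderSubsemiring (edgeGenerators l d)
      rw [map_add, AlgHom.commutes, addLabels_z]
      exact add_z_mem_preorder _ _ _ _
    · change addLabels h (algebraMap ℝ _ d - z p.1.1 p.1.2 p.2.ne) ∈
        preorderSubsemiring (edgeGenerators l d)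
      rw [map_sub, AlgHom.commutes, addLabels_z]
      exact sub_z_mem_preorder _ _ _ _

/-- The preorder contains `d ^ m + w` and `d ^ m - w` for each monomial `w` of degree `m`, since
`2 (dᵐ⁺¹ ± w z) = (dᵐ + w) (d ± z) + (dᵐ - w) (d ∓ z)`. The sign of `d` does not matter. -/
theorem pow_card_add_sub_monomial_mem_preorder (d : ℝ) (E : Multiset (Sym2 (Fin k ⊕ Fin 0)))
    (hE : ∀ e ∈ E, ¬ e.IsDiag) :
    algebraMap ℝ (degZero k) (d ^ E.card) + monomial E hE ∈
        preorderSubsemiring (edgeGenerators k d) ∧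
      algebraMap ℝ (degZero k) (d ^ E.card) - monomial E hE ∈
        preorderSubsemiring (edgeGenerators k d) := by
  induction E using Multiset.induction_on with
  | empty =>
    rw [monomial_zero]
    simp only [Multiset.card_zero, pow_zero, map_one, sub_self]
    exact ⟨add_mem (one_mem _) (one_mem _), zero_mem _⟩
  | cons e E ih =>
    induction e using Sym2.inductionOn with
    | _ u v =>
    obtain i | i := u
    swap
    · exact i.elim0
    obtain j | j := v
    swap
    · exact j.elim0
    have hij : i ≠ j := by simpa using hE _ (Multiset.mem_cons_self _ _)
    obtain ⟨hp, hm⟩ := ih fun e he => hE e (Multiset.mem_cons_of_mem he)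
    have zp := add_z_mem_preorder d i j hij
    have zm := sub_z_mem_preorder d i j hij
    rw [monomial_cons hij, Multiset.card_cons]
    generalize monomial E _ = w at *
    have half : (0 : ℝ) ≤ 1 / 2 := by norm_num
    have cancel : ∀ x : degZero k, (1 / 2 : ℝ) • (2 * x) = x := fun x => by
      rw [← map_ofNat (algebraMap ℝ (degZero k)) 2, ← Algebra.smul_def, smul_smul]
      norm_num
    constructor
    · have := smul_mem_preorderSubsemiring _ half (add_mem (mul_mem hp zp) (mul_mem hm zm))
      rw [← cancel (_ + _)]
      convert this using 2
      rw [pow_succ, map_mul]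
      ring
    · have := smul_mem_preorderSubsemiring _ half (add_mem (mul_mem hp zm) (mul_mem hm zp))
      rw [← cancel (_ - _)]
      convert this using 2
      rw [pow_succ, map_mul]
      ring

end EdgePreorder

/-! ### The cone of certified quantum multigraphs -/

section CertifiedCone

open GraphAlgebra

/-- The convex cone of all quantum multigraphs that coincide, up to labels and isolated vertices,
with an element of `𝒫ₖ(d)` for some `k`. -/
noncomputable def certifiedCone (d : ℝ) : PointedCone ℝ (GraphAlgebra 0) where
  carrier := {a | ∃ (k : ℕ) (σ : degZero k), σ ∈ edgePreorder k d ∧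
    Coincide a (σ : GraphAlgebra k)}
  zero_mem' := ⟨0, 0, mem_edgePreorder.2 (zero_mem _), by simp [Coincide]⟩
  add_mem' := by
    rintro a b ⟨k, σ, hσ, ha⟩ ⟨l, τ, hτ, hb⟩
    refine ⟨max k l, addLabels (le_max_left k l) σ + addLabels (le_max_right k l) τ,
      mem_edgePreorder.2 (add_mem (addLabels_mem_preorder _ hσ) (addLabels_mem_preorder _ hτ)), ?_⟩
    have h1 := sub_mem ha (unlabel_addLabels_sub_unlabel_mem (le_max_left k l) σ)
    have h2 := sub_mem hb (unlabel_addLabels_sub_unlabel_mem (le_max_right k l) τ)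
    have := add_mem h1 h2
    unfold Coincide
    rw [AddMemClass.coe_add, map_add]
    convert this using 1
    abel
  smul_mem' := by
    rintro ⟨c, hc⟩ a ⟨k, σ, hσ, ha⟩
    refine ⟨k, c • σ, mem_edgePreorder.2 (smul_mem_preorderSubsemiring _ hc hσ), ?_⟩
    have := isolatedSpan.smul_mem c ha
    rw [smul_sub, ← map_smul] at this
    exact this

theorem mem_certifiedCone {d : ℝ} {a : GraphAlgebra 0} :
    a ∈ certifiedCone d ↔ ∃ (k : ℕ) (σ : degZero k), σ ∈ edgePreorder k d ∧
      Coincide a (σ : GraphAlgebra k) := Iff.rfl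

theorem mem_certifiedCone_of_mem_isolatedSpan (d : ℝ) {a : GraphAlgebra 0} (ha : a ∈ isolatedSpan) :
    a ∈ certifiedCone d :=
  ⟨0, 0, mem_edgePreorder.2 (zero_mem _), by simpa [Coincide] using ha⟩

theorem unlabel_mem_certifiedCone {d : ℝ} {k : ℕ} {σ : degZero k} (hσ : σ ∈ edgePreorder k d) :
    unlabel k σ ∈ certifiedCone d :=
  ⟨k, σ, hσ, by simp [Coincide]⟩

/-- An unlabeled multigraph coincides with the fully labeled one obtained by labeling all of its
vertices. -/
theorem coincide_monomial (H : LabeledMultigraph 0) (c s : ℝ) :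
    Coincide (c • 1 + s • MonoidAlgebra.single (GraphClass.mk H) 1 : GraphAlgebra 0)
      ((algebraMap ℝ (degZero H.n) c + s • monomial (H.edges.map (Sym2.map Sum.swap))
        (LabeledMultigraph.loopless_map H.loopless Sum.swap_leftInverse.injective) :
        degZero H.n) : GraphAlgebra H.n) := by
  have h1 := single_sub_single_mem_isolatedSpan (H := LabeledMultigraph.empty 0)
    (H' := (LabeledMultigraph.empty H.n).unlabel) (f := Fin.elim0) (fun x => x.elim0) rfl
  have h2 := single_sub_single_mem_isolatedSpan (H := H)
    (H' := LabeledMultigraph.unlabel (k := H.n) ⟨0, H.edges.map (Sym2.map Sum.swap),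
      LabeledMultigraph.loopless_map H.loopless Sum.swap_leftInverse.injective⟩)
    (f := Fin.castAdd 0) (Fin.castAdd_injective _ _) (by
      refine Eq.trans ?_ (LabeledMultigraph.map_map _ _ _).symm
      refine congrArg (fun g => Multiset.map (Sym2.map g) _) (funext ?_)
      rintro (x | x)
      · exact x.elim0
      · rfl)
  have := neg_mem (add_mem (isolatedSpan.smul_mem c h1) (isolatedSpan.smul_mem s h2))
  unfold Coincide
  rw [AddMemClass.coe_add, map_add, Algebra.algebraMap_eq_smul_one, SetLike.val_smul,
    SetLike.val_smul, map_smul, map_smul, OneMemClass.coe_one, MonoidAlgebra.one_def,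
    MonoidAlgebra.one_def]
  unfold monomial
  rw [unlabel_single, unlabel_single]
  convert this using 1
  change c • MonoidAlgebra.single (GraphClass.mk _) (1 : ℝ) + _ -
    (c • MonoidAlgebra.single (GraphClass.mk _) (1 : ℝ) +
      s • MonoidAlgebra.single (GraphClass.mk _) (1 : ℝ)) = _
  module

theorem pow_card_add_sub_single_mem_certifiedCone (d : ℝ) (H : LabeledMultigraph 0) :
    (d ^ H.edges.card) • 1 + MonoidAlgebra.single (GraphClass.mk H) 1 ∈ certifiedCone d ∧
      (d ^ H.edges.card) • 1 - MonoidAlgebra.single (GraphClass.mk H) 1 ∈ certifiedCone d := by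
  have h := pow_card_add_sub_monomial_mem_preorder d (H.edges.map (Sym2.map Sum.swap))
    (LabeledMultigraph.loopless_map H.loopless Sum.swap_leftInverse.injective)
  rw [Multiset.card_map] at h
  constructor
  · have := coincide_monomial H (d ^ H.edges.card) 1
    rw [one_smul, one_smul] at this
    exact ⟨_, _, h.1, this⟩
  · have := coincide_monomial H (d ^ H.edges.card) (-1)
    rw [neg_one_smul, neg_one_smul, ← sub_eq_add_neg, ← sub_eq_add_neg] at this
    exact ⟨_, _, h.2, this⟩

theorem one_mem_certifiedCone (d : ℝ) : 1 ∈ certifiedCone d :=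
  ⟨0, 1, mem_edgePreorder.2 (one_mem _), by
    have : unlabel 0 1 = 1 := by
      rw [MonoidAlgebra.one_def, unlabel_single]
      rfl
    simp [Coincide, this]⟩

/-- The identity is an order unit of the cone. -/
theorem exists_smul_one_add_mem_certifiedCone (d : ℝ) (a : GraphAlgebra 0) :
    ∃ N : ℝ, N • 1 + a ∈ certifiedCone d := by
  have smul_mem : ∀ {c : ℝ}, 0 ≤ c → ∀ {x}, x ∈ certifiedCone d → c • x ∈ certifiedCone d :=
    fun {c} hc {x} hx => Submodule.smul_mem (certifiedCone d) (⟨c, hc⟩ : NNReal) hx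
  induction a using MonoidAlgebra.induction_linear with
  | zero => exact ⟨0, by simp⟩
  | add a b ha hb =>
    obtain ⟨M, hM⟩ := ha
    obtain ⟨N, hN⟩ := hb
    refine ⟨M + N, ?_⟩
    rw [add_smul, add_add_add_comm]
    exact add_mem hM hN
  | single G c =>
    induction G using Quotient.inductionOn with
    | _ H =>
    obtain ⟨hp, hm⟩ := pow_card_add_sub_single_mem_certifiedCone d H
    have hG : (MonoidAlgebra.single (GraphClass.mk H) c : GraphAlgebra 0) =
        c • MonoidAlgebra.single (GraphClass.mk H) 1 := by simp
    change ∃ N : ℝ, N • 1 + MonoidAlgebra.single (GraphClass.mk H) c ∈ _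
    rw [hG]
    rcases le_total 0 c with hc | hc
    · refine ⟨c * d ^ H.edges.card, ?_⟩
      rw [mul_smul, ← smul_add]
      exact smul_mem hc hp
    · refine ⟨-c * d ^ H.edges.card, ?_⟩
      have := smul_mem (neg_nonneg.2 hc) hm
      rwa [smul_sub, smul_smul, neg_smul, sub_neg_eq_add] at this

end CertifiedCone

/-! ### Graph parameters as functionals on the cone -/

namespace GraphParameter

open GraphAlgebra

variable {t : GraphParameter}

@[simp]
theorem eval_single (t : GraphParameter) (G : GraphClass 0) (c : ℝ) :
    t.eval (MonoidAlgebra.single G c) = c * t G := by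
  simp [eval]

theorem eval_eq_zero_of_mem_isolatedSpan (ht : t.IsolateIndifferent) {a : GraphAlgebra 0}
    (ha : a ∈ isolatedSpan) : t.eval a = 0 := by
  refine (Submodule.span_le (p := LinearMap.ker t.eval)).2 ?_ ha
  rintro _ ⟨G, rfl⟩
  simp [ht G]

theorem evalLabeled_z_pow (ht : t.IsolateIndifferent) {k : ℕ} (i j : Fin k) (hij : i ≠ j)
    (m : ℕ) : t.evalLabeled k (z i j hij ^ m : degZero k) =
      t (GraphClass.mk (LabeledMultigraph.multiEdge m)) := by
  have hE : ∀ e ∈ Multiset.replicate m s(Sum.inl i, Sum.inl (β := Fin 0) j), ¬ e.IsDiag := by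
    intro e he
    rw [Multiset.eq_of_mem_replicate he]
    simpa using hij
  have hf : Function.Injective (![Fin.castAdd 0 i, Fin.castAdd 0 j] : Fin 2 → Fin (k + 0)) := by
    intro x y
    fin_cases x <;> fin_cases y <;> simp [hij, hij.symm]
  rw [coe_z_pow, GraphClass.mk_edge_pow hij m hE]
  have h := single_sub_single_mem_isolatedSpan (H := LabeledMultigraph.multiEdge m)
    (H' := LabeledMultigraph.unlabel ⟨0, _, hE⟩)
    (f := ![Fin.castAdd 0 i, Fin.castAdd 0 j]) hf
    ((Multiset.map_replicate _ _ _).trans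
      (Multiset.map_replicate (Sym2.map (Sum.inr ∘ finSumFinEquiv)) m
        s(Sum.inl i, Sum.inl j)).symm)
  have := eval_eq_zero_of_mem_isolatedSpan ht h
  rw [map_sub, eval_single, eval_single, one_mul, one_mul, sub_eq_zero] at this
  rw [evalLabeled, LinearMap.comp_apply, unlabel_single, eval_single, one_mul]
  exact this

/-- An isolate indifferent, flatly reflection positive and `d`-bounded graph parameter is
nonnegative on the preorders `𝒫ₖ(d)`. -/
theorem evalLabeled_nonneg_of_mem_edgePreorder {d : ℝ} (ht : t.IsolateIndifferent)
    (hpos : t.FlatlyReflectionPositive) (hd : IsBoundedBy d t) {k : ℕ} {σ : degZero k}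
    (hσ : σ ∈ edgePreorder k d) : 0 ≤ t.evalLabeled k σ := by
  have hd0 : 0 ≤ d := by simpa using (abs_nonneg _).trans (hd 1)
  obtain ⟨s, hs, rfl⟩ := hσ
  let L : degZero k →ₗ[ℝ] ℝ := t.evalLabeled k ∘ₗ (degZero k).val.toLinearMap
  change 0 ≤ L _
  have hL : ∀ b, 0 ≤ L (b ^ 2) := fun b => hpos k b b.2
  -- write all generators in the form `d + y`, with `y` an edge variable or its negative
  let y : {p : Fin k × Fin k // p.1 < p.2} ⊕ {p : Fin k × Fin k // p.1 < p.2} → degZero k :=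
    Sum.elim (fun p => z p.1.1 p.1.2 p.2.ne) (fun p => -z p.1.1 p.1.2 p.2.ne)
  have hy : edgeGenerators k d = fun i => algebraMap ℝ (degZero k) d + y i := by
    funext i
    obtain p | p := i
    · rfl
    · exact sub_eq_add_neg _ _
  have hz : ∀ p : {p : Fin k × Fin k // p.1 < p.2}, ∀ m : ℕ,
      L (z p.1.1 p.1.2 p.2.ne ^ (2 * m)) ≤ 1 * d ^ (2 * m) := fun p m => by
    rw [one_mul]
    exact (evalLabeled_z_pow ht _ _ p.2.ne (2 * m)).trans_le ((le_abs_self _).trans (hd _))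
  have hmom : ∀ i, ∃ C, ∀ m : ℕ, L (y i ^ (2 * m)) ≤ C * d ^ (2 * m) := by
    rintro (p | p)
    · exact ⟨1, hz p⟩
    · refine ⟨1, fun m => ?_⟩
      have : (-z p.1.1 p.1.2 p.2.ne : degZero k) ^ (2 * m) = z p.1.1 p.1.2 p.2.ne ^ (2 * m) :=
        Even.neg_pow (α := degZero k) (even_two_mul m) (z p.1.1 p.1.2 p.2.ne)
      exact (congrArg L this).trans_le (hz p m)
  change 0 ≤ L (∑ S, s S * ∏ i ∈ S, edgeGenerators k d i)
  rw [hy, map_sum]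
  refine Finset.sum_nonneg fun S _ => ?_
  have h := hs S
  generalize s S = x at h ⊢
  induction h with
  | zero => simp
  | sq_add b _ ih =>
    rw [add_mul, map_add, ← sq]
    exact add_nonneg (apply_sq_mul_prod_nonneg hd0 y S L hL hmom b) ih

theorem eval_nonneg_of_mem_certifiedCone {d : ℝ} (ht : t.IsolateIndifferent)
    (hpos : t.FlatlyReflectionPositive) (hd : IsBoundedBy d t) {a : GraphAlgebra 0}
    (ha : a ∈ certifiedCone d) : 0 ≤ t.eval a := by
  obtain ⟨k, σ, hσ, h⟩ := ha
  have h1 := eval_eq_zero_of_mem_isolatedSpan ht h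
  rw [map_sub, sub_eq_zero] at h1
  rw [h1]
  exact evalLabeled_nonneg_of_mem_edgePreorder ht hpos hd hσ

/-- The graph parameter given by a functional on the quantum multigraphs. -/
noncomputable def ofFunctional (g : GraphAlgebra 0 →ₗ[ℝ] ℝ) : GraphParameter :=
  fun G => g (MonoidAlgebra.single G 1)

theorem eval_ofFunctional (g : GraphAlgebra 0 →ₗ[ℝ] ℝ) : (ofFunctional g).eval = g := by
  refine LinearMap.ext fun a => ?_
  induction a using MonoidAlgebra.induction_linear with
  | zero => simp
  | add a b ha hb => rw [map_add, map_add, ha, hb]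
  | single G c =>
    rw [eval_single, ofFunctional, ← smul_eq_mul, ← map_smul, MonoidAlgebra.smul_single,
      smul_eq_mul, mul_one]

section OfFunctional

variable {d : ℝ} {g : GraphAlgebra 0 →ₗ[ℝ] ℝ}

theorem isolateIndifferent_ofFunctional (hg : ∀ a ∈ certifiedCone d, 0 ≤ g a) :
    (ofFunctional g).IsolateIndifferent := fun G => by
  have h : (MonoidAlgebra.single (G * GraphClass.mk LabeledMultigraph.singleVertex) 1 -
      MonoidAlgebra.single G 1 : GraphAlgebra 0) ∈ isolatedSpan :=
    Submodule.subset_span ⟨G, rfl⟩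
  have h1 := hg _ (mem_certifiedCone_of_mem_isolatedSpan d h)
  have h2 := hg _ (mem_certifiedCone_of_mem_isolatedSpan d (neg_mem h))
  rw [map_neg] at h2
  rw [map_sub] at h1 h2
  unfold ofFunctional
  linarith

theorem flatlyReflectionPositive_ofFunctional (hg : ∀ a ∈ certifiedCone d, 0 ≤ g a) :
    (ofFunctional g).FlatlyReflectionPositive := fun k b hb => by
  let c : degZero k := ⟨b, hb⟩
  have hc : c * c ∈ edgePreorder k d :=
    mem_edgePreorder.2 ((IsSumSq.mul_self c).mem_preorderSubsemiring _)
  have h := hg _ (unlabel_mem_certifiedCone hc)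
  rw [MulMemClass.coe_mul, ← sq] at h
  rw [evalLabeled, eval_ofFunctional]
  exact h

theorem isBoundedBy_ofFunctional (hg : ∀ a ∈ certifiedCone d, 0 ≤ g a) (hg1 : g 1 = 1) :
    IsBoundedBy d (ofFunctional g) := fun m => by
  obtain ⟨hp, hm⟩ := pow_card_add_sub_single_mem_certifiedCone d (LabeledMultigraph.multiEdge m)
  have hcard : (LabeledMultigraph.multiEdge m).edges.card = m := Multiset.card_replicate _ _
  have h1 := hg _ hp
  have h2 := hg _ hm
  rw [hcard, map_add, map_smul, hg1, smul_eq_mul, mul_one] at h1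
  rw [hcard, map_sub, map_smul, hg1, smul_eq_mul, mul_one] at h2
  unfold ofFunctional
  rw [abs_le]
  constructor <;> linarith

end OfFunctional

end GraphParameter

/-! ### The Positivstellensatz -/

theorem theorem3p3 (d : ℝ) (a : GraphAlgebra 0) :
    (∀ t : GraphParameter, t.IsolateIndifferent → t.FlatlyReflectionPositive →
        GraphParameter.IsBoundedBy d t → 0 ≤ t.eval a) ↔
      ∀ ε : ℝ, 0 < ε → ∃ (k : ℕ) (σ : GraphAlgebra.degZero k), σ ∈ edgePreorder k d ∧
        GraphAlgebra.Coincide (a + algebraMap ℝ (GraphAlgebra 0) ε) (σ : GraphAlgebra k) := by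
  constructor
  · intro h ε hε
    rw [← mem_certifiedCone]
    by_contra hmem
    obtain ⟨g, hg1, hg, hga⟩ := PointedCone.exists_apply_nonpos_of_notMem (certifiedCone d)
      (one_mem_certifiedCone d) (exists_smul_one_add_mem_certifiedCone d) hmem
    have ha := h (GraphParameter.ofFunctional g)
      (GraphParameter.isolateIndifferent_ofFunctional hg)
      (GraphParameter.flatlyReflectionPositive_ofFunctional hg)
      (GraphParameter.isBoundedBy_ofFunctional hg hg1)
    rw [GraphParameter.eval_ofFunctional] at ha
    rw [map_add, Algebra.algebraMap_eq_smul_one, map_smul, hg1, smul_eq_mul, mul_one] at hga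
    linarith
  · intro h t ht hpos hd
    have h1 : 0 ≤ t.eval 1 :=
      GraphParameter.eval_nonneg_of_mem_certifiedCone ht hpos hd (one_mem_certifiedCone d)
    have hε : ∀ ε : ℝ, 0 < ε → 0 ≤ t.eval a + ε * t.eval 1 := fun ε hε => by
      have := GraphParameter.eval_nonneg_of_mem_certifiedCone ht hpos hd
        (mem_certifiedCone.2 (h ε hε))
      rwa [map_add, Algebra.algebraMap_eq_smul_one, map_smul, smul_eq_mul] at this
    by_contra! hneg
    -- `t.eval 1` need not be `1`, it may even vanish, which the choice of `ε` takes into account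
    have := hε (-t.eval a / (t.eval 1 + 1)) (by apply div_pos <;> linarith)
    rw [div_mul_eq_mul_div, ← sub_nonneg] at this
    have h2 : -t.eval a * t.eval 1 / (t.eval 1 + 1) < -t.eval a := by
      rw [div_lt_iff₀ (by linarith)]
      linarith
    linarith
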